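/- Consider a slotted-time system with three infinite-buffer queues: $Q_p$ (packets of the primary user, PU), $Q_{sp}$ (PU packets relayed by the secondary user, SU) and $Q_s$ (the SU's own packets), with an arbitrary deterministic initial state. Let $0<f_{pd}<f_{sd}\le 1$ and $f_{ps}\in[0,1]$ be the reception probabilities of the links PU–destination, SU–destination and PU–SU, and fix a service probability $p_q\in(0,1)$ and an admission probability $p_a\in[0,1]$. In every slot a packet arrives at $Q_p$ with probability $\lambda_p\in[0,1]$ and at $Q_s$ with probability $\lambda_s\in[0,1]$. If $Q_p$ is non-empty at the beginning of the slot, the PU transmits a packet and the SU is silent; the packet leaves the system if the destination receives it; if the destination does not receive it but the SU decodes it, it is moved from $Q_p$ to $Q_{sp}$ with probability $p_a$; otherwise it stays in $Q_p$. If $Q_p$ is empty, the SU selects $Q_s$ with probability $p_q$ and $Q_{sp}$ with probability $1-p_q$, transmits a packet of the selected queue (if it has one), and the packet leaves the system if it is received by the destination. Arrivals, link outcomes, admission decisions and queue selections are mutually independent and independent across slots. Queue lengths are observed at the beginning of each slot and evolve as $Q_k^{t+1}=[Q_k^t-Y_k^t]^++X_k^t$, where $Y_k^t,X_k^t\in\{0,1\}$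 are the departures and arrivals of slot $t$. A queue is called stable if its length converges in distribution, as $t\to\infty$, to a finite random variable, and the system is called stable if all three queues are stable. Then the system is stable if and only if $$\lambda_s<p_q f_{sd}\left[1-\frac{\lambda_p}{f_{pd}+p_af_{ps}(1-f_{pd})}\right]\quad\text{and}\quad \lambda_p<\frac{f_{sd}(1-p_q)\,[f_{pd}+p_af_{ps}(1-f_{pd})]}{f_{sd}(1-p_q)+p_af_{ps}(1-f_{pd})}.$$ The same equivalence holds when stability of a queue is understood as boundedness in probability, i.e. tightness of the sequence of its lengths. -/

import Mathlib

open MeasureTheory ProbabilityTheory Filter Topology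

namespace CognitiveRelay

/-- Parameters of the network and of the policy: reception probabilities PU to destination,
PU to SU and SU to destination; the probability `pq` that the SU serves its own queue when the PU
is idle; the admission probability `pa` of the relay queue. -/
structure Params where
  fpd : ℝ
  fps : ℝ
  fsd : ℝ
  pq : ℝ
  pa : ℝ

/-- Parameters are probabilities; the direct PU link is strictly worse than the SU link;
both SU queues are selected with positive probability; the direct link is not dead. -/
structure Params.Admissible (θ : Params) : Prop where
  fpd_pos : 0 < θ.fpd
  fpd_lt_fsd : θ.fpd < θ.fsd
  fsd_le_one : θ.fsd ≤ 1
  fps_nonneg : 0 ≤ θ.fps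
  fps_le_one : θ.fps ≤ 1
  pq_pos : 0 < θ.pq
  pq_lt_one : θ.pq < 1
  pa_nonneg : 0 ≤ θ.pa
  pa_le_one : θ.pa ≤ 1

/-- The binary random quantities of one time slot. -/
inductive Coin
  | arrP    -- a packet arrives at the PU
  | arrS    -- a packet arrives at the SU
  | chanPD  -- no outage on the link PU to destination
  | chanPS  -- no outage on the link PU to SU
  | chanSD  -- no outage on the link SU to destination
  | accept  -- the relay queue is willing to buffer an overheard packet
  | own     -- the SU selects its own queue (otherwise the relay queue)

/-- Success probability of each binary quantity, given the arrival rates. -/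
def Params.prob (θ : Params) (lamP lamS : ℝ) : Coin → ℝ
  | .arrP => lamP
  | .arrS => lamS
  | .chanPD => θ.fpd
  | .chanPS => θ.fps
  | .chanSD => θ.fsd
  | .accept => θ.pa
  | .own => θ.pq

/-- `B c t` is the binary quantity `c` in slot `t`: all of them are mutually independent, and those
of kind `c` are Bernoulli with the prescribed probability in every slot. -/
structure IsInput {Ω : Type*} [MeasurableSpace Ω] (P : Measure Ω) (θ : Params) (lamP lamS : ℝ)
    (B : Coin → ℕ → Ω → Bool) : Prop where
  measurable : ∀ c t, Measurable (B c t)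
  indep : iIndepFun (fun i : Coin × ℕ => B i.1 i.2) P
  law : ∀ c t, P.real {ω | B c t ω = true} = θ.prob lamP lamS c

/-- Queue lengths: PU queue, relay queue at the SU, SU's own queue. -/
structure State where
  p : ℕ
  sp : ℕ
  s : ℕ

/-- The PU packet sent in this slot (if any) reaches the destination. -/
def direct (q : State) (b : Coin → Bool) : Bool :=
  decide (0 < q.p) && b .chanPD

/-- The PU packet sent in this slot (if any) misses the destination, is decoded by the SU and is
buffered in the relay queue. -/
def relayed (q : State) (b : Coin → Bool) : Bool :=
  decide (0 < q.p) && !b .chanPD && b .chanPS && b .accept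

/-- The PU is idle and the SU's own queue is selected and gets a successful slot. -/
def serveS (q : State) (b : Coin → Bool) : Bool :=
  decide (q.p = 0) && b .own && b .chanSD

/-- The PU is idle and the relay queue is selected and gets a successful slot. -/
def serveSP (q : State) (b : Coin → Bool) : Bool :=
  decide (q.p = 0) && !b .own && b .chanSD

/-- One slot: every queue evolves as `[Q - Y]⁺ + X` (subtraction on `ℕ` is truncated at `0`). -/
def step (q : State) (b : Coin → Bool) : State where
  p := q.p - (direct q b || relayed q b).toNat + (b .arrP).toNat
  sp := q.sp - (serveSP q b).toNat + (relayed q b).toNat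
  s := q.s - (serveS q b).toNat + (b .arrS).toNat

/-- The queue lengths at the beginning of slot `t`, started from `q₀`. -/
def queues {Ω : Type*} (B : Coin → ℕ → Ω → Bool) (q₀ : State) : ℕ → Ω → State
  | 0, _ => q₀
  | t + 1, ω => step (queues B q₀ t ω) (fun c => B c t ω)

/-- A queue is stable if its length converges in distribution to an honest (finite) random
variable. -/
def StableQueue {Ω : Type*} [MeasurableSpace Ω] (P : Measure Ω) (Q : ℕ → Ω → ℕ) : Prop :=
  ∃ F : ℕ → ℝ, (∀ m, Tendsto (fun t => P.real {ω | Q t ω ≤ m}) atTop (𝓝 (F m))) ∧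
    Tendsto F atTop (𝓝 1)

/-- A queue is bounded in probability if its lengths form a tight sequence. -/
def BoundedQueue {Ω : Type*} [MeasurableSpace Ω] (P : Measure Ω) (Q : ℕ → Ω → ℕ) : Prop :=
  ∀ ε : ℝ, 0 < ε → ∃ m : ℕ, ∀ t, P.real {ω | m < Q t ω} ≤ ε

/-- All three queues are stable. -/
def StableSystem {Ω : Type*} [MeasurableSpace Ω] (P : Measure Ω) (Q : ℕ → Ω → State) : Prop :=
  StableQueue P (fun t ω => (Q t ω).p) ∧ StableQueue P (fun t ω => (Q t ω).sp) ∧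
    StableQueue P (fun t ω => (Q t ω).s)

/-- All three queues are bounded in probability. -/
def BoundedSystem {Ω : Type*} [MeasurableSpace Ω] (P : Measure Ω) (Q : ℕ → Ω → State) : Prop :=
  BoundedQueue P (fun t ω => (Q t ω).p) ∧ BoundedQueue P (fun t ω => (Q t ω).sp) ∧
    BoundedQueue P (fun t ω => (Q t ω).s)

/-- The claimed stable throughput region, as a set of pairs `(lamP, lamS)`. -/
def Params.region (θ : Params) : Set (ℝ × ℝ) :=
  {l | l.2 < θ.pq * θ.fsd * (1 - l.1 / (θ.fpd + θ.pa * θ.fps * (1 - θ.fpd))) ∧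
    l.1 < θ.fsd * (1 - θ.pq) * (θ.fpd + θ.pa * θ.fps * (1 - θ.fpd)) /
      (θ.fsd * (1 - θ.pq) + θ.pa * θ.fps * (1 - θ.fpd))}

end CognitiveRelay

/-! The queues form a Markov chain driven by i.i.d. finite noise. With transition operator `T`, the
expectation of `g` in slot `t` from state `q` is `(T ^ t) g q` (`integral_queues`), so everything
reduces to powers of a positive linear operator.

Sufficiency. Each SU queue `ψ` is treated together with the PU queue only, through the Lyapunov
function `W = ψ + c * p`. A slope `c` making the drift negative both when the PU is busy and when it
is idle exists under the inequality of the region for that queue (`exists_slope`), and a Foster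
argument with exponential moments gives tightness. Convergence in law then comes from monotonicity:
started empty, the chain increases stochastically, so its distribution functions converge. Started
elsewhere, it lies above that chain and differs from it at most by the probability of not having
emptied yet, which tends to `0` (`tendsto_transfer_pow`).

Necessity. A tight queue with bounded increments has asymptotically zero mean drift. The balance
equations of `p` and `ψ` determine the long-run frequency of slots in which both are empty
(`exists_idle_frequency`). This frequency is nonnegative, which gives the weak inequalities; it is
positive because a tight pair of queues empties with probability bounded below, which makes them
strict. -/

namespace CognitiveRelay

/-! ### Transition operators of chains with finite noise, plain and killed. -/

section Chain

variable {S β : Type*} [Fintype β]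

/-- The transition operator of the Markov chain `x ↦ f x b`, where the noise `b` has law `w`. -/
def transfer (w : β → ℝ) (f : S → β → S) : (S → ℝ) →ₗ[ℝ] (S → ℝ) where
  toFun g x := ∑ b, w b * g (f x b)
  map_add' g h := by
    ext x
    simp [mul_add, Finset.sum_add_distrib]
  map_smul' c g := by
    ext x
    simp only [Pi.smul_apply, smul_eq_mul, RingHom.id_apply, Finset.mul_sum]
    exact Finset.sum_congr rfl fun b _ => by ring

/-- The transition operator of the chain killed when it sits at `z`. -/
noncomputable def killed (w : β → ℝ) (f : S → β → S) (z : S) : (S → ℝ) →ₗ[ℝ] (S → ℝ) where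
  toFun g := ({z}ᶜ : Set S).indicator (transfer w f g)
  map_add' g h := by
    rw [map_add, Set.indicator_add']
  map_smul' c g := by
    ext x
    by_cases hx : x = z <;> simp [hx]

variable {w : β → ℝ} {f : S → β → S}

theorem transfer_apply (g : S → ℝ) (x : S) : transfer w f g x = ∑ b, w b * g (f x b) := rfl

theorem transfer_pow_succ_apply (t : ℕ) (g : S → ℝ) (x : S) :
    (transfer w f ^ (t + 1)) g x = ∑ b, w b * (transfer w f ^ t) g (f x b) := by
  rw [pow_succ', Module.End.mul_apply, transfer_apply]

theorem killed_apply_self (g : S → ℝ) (z : S) : killed w f z g z = 0 := by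
  simp [killed]

theorem killed_apply_of_ne (g : S → ℝ) {x z : S} (h : x ≠ z) :
    killed w f z g x = transfer w f g x := by
  simp [killed, h]

theorem indicator_one_nonneg (s : Set S) : (0 : S → ℝ) ≤ s.indicator 1 :=
  Set.indicator_nonneg fun _ _ => zero_le_one

theorem monotone_pow {T : (S → ℝ) →ₗ[ℝ] (S → ℝ)} (hT : Monotone T) (t : ℕ) :
    Monotone (T ^ t : (S → ℝ) →ₗ[ℝ] (S → ℝ)) := by
  rw [Module.End.coe_pow]
  exact hT.iterate t

theorem transfer_mono (hw : w ∈ stdSimplex ℝ β) : Monotone (transfer w f) := fun _ _ h x =>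
  Finset.sum_le_sum fun b _ => mul_le_mul_of_nonneg_left (h (f x b)) (hw.1 b)

theorem transfer_one (hw : w ∈ stdSimplex ℝ β) : transfer w f 1 = 1 := by
  ext x
  simp [transfer_apply, hw.2]

theorem transfer_pow_one (hw : w ∈ stdSimplex ℝ β) (t : ℕ) : (transfer w f ^ t) 1 = 1 := by
  induction t with
  | zero => rfl
  | succ t ih => rw [pow_succ, Module.End.mul_apply, transfer_one hw, ih]

theorem transfer_pow_nonneg (hw : w ∈ stdSimplex ℝ β) (t : ℕ) {g : S → ℝ} (hg : 0 ≤ g) :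
    0 ≤ (transfer w f ^ t) g := by
  simpa using monotone_pow (transfer_mono (f := f) hw) t hg

theorem transfer_pow_le_one (hw : w ∈ stdSimplex ℝ β) (t : ℕ) {g : S → ℝ} (hg : g ≤ 1) :
    (transfer w f ^ t) g ≤ 1 := by
  simpa [transfer_pow_one hw] using monotone_pow (transfer_mono (f := f) hw) t hg

theorem killed_le (hw : w ∈ stdSimplex ℝ β) {z : S} {g : S → ℝ} (hg : 0 ≤ g) :
    killed w f z g ≤ transfer w f g := fun x => by
  by_cases h : x = z
  · subst h
    rw [killed_apply_self]
    simpa using transfer_mono (f := f) hw hg x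
  · rw [killed_apply_of_ne _ h]

theorem killed_mono (hw : w ∈ stdSimplex ℝ β) (z : S) : Monotone (killed w f z) := fun g h hgh x => by
  by_cases hx : x = z
  · subst hx
    simp [killed_apply_self]
  · rw [killed_apply_of_ne _ hx, killed_apply_of_ne _ hx]
    exact transfer_mono hw hgh x

theorem killed_pow_nonneg (hw : w ∈ stdSimplex ℝ β) (z : S) (t : ℕ) {g : S → ℝ} (hg : 0 ≤ g) :
    0 ≤ (killed w f z ^ t) g := by
  simpa using monotone_pow (killed_mono (f := f) hw z) t hg

theorem killed_pow_le (hw : w ∈ stdSimplex ℝ β) (z : S) (t : ℕ) {g : S → ℝ} (hg : 0 ≤ g) :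
    (killed w f z ^ t) g ≤ (transfer w f ^ t) g := by
  induction t with
  | zero => rfl
  | succ t ih =>
    rw [pow_succ', pow_succ', Module.End.mul_apply, Module.End.mul_apply]
    exact (killed_le hw (killed_pow_nonneg hw z t hg)).trans (transfer_mono hw ih)

theorem killed_pow_one_antitone (hw : w ∈ stdSimplex ℝ β) (z : S) :
    Antitone fun t => (killed w f z ^ t) (1 : S → ℝ) := by
  refine antitone_nat_of_succ_le fun t => ?_
  rw [pow_succ, Module.End.mul_apply]
  refine monotone_pow (killed_mono hw z) t ?_
  exact (killed_le hw zero_le_one).trans (transfer_one hw).le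

/-- The chance of having visited `z` before time `n + 1` is at least that of sitting there at
time `n`. -/
theorem killed_pow_succ_one_le (hw : w ∈ stdSimplex ℝ β) (z : S) (n : ℕ) :
    (killed w f z ^ (n + 1)) (1 : S → ℝ) ≤ 1 - (transfer w f ^ n) (({z} : Set S).indicator 1) := by
  have hle : (({z} : Set S).indicator 1 : S → ℝ) ≤ 1 :=
    Set.indicator_le_self' fun _ _ => zero_le_one
  -- Killing acts on leaving `z`, not on entering it, hence the power `n + 1` for a visit at time
  -- `n`.
  have key : ∀ n x, x = z → (killed w f z ^ (n + 1)) (1 : S → ℝ) x ≤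
      (1 - (transfer w f ^ n) (({z} : Set S).indicator 1)) x := by
    rintro n x rfl
    rw [pow_succ', Module.End.mul_apply, killed_apply_self]
    simpa using transfer_pow_le_one (f := f) hw n hle x
  induction n with
  | zero =>
    intro x
    by_cases hx : x = z
    · exact key 0 x hx
    · simp [killed_apply_of_ne _ hx, transfer_one hw, hx]
  | succ n ih =>
    intro x
    by_cases hx : x = z
    · exact key _ x hx
    · rw [pow_succ', Module.End.mul_apply, killed_apply_of_ne _ hx]
      refine (transfer_mono hw ih x).trans_eq ?_
      rw [map_sub, transfer_one hw, ← Module.End.mul_apply, ← pow_succ']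

/-! ### Monotone chains and comparison with the chain started from the least state. -/

theorem transfer_antitone [Preorder S] (hw : w ∈ stdSimplex ℝ β)
    (hf : ∀ b, Monotone fun x => f x b) {g : S → ℝ} (hg : Antitone g) :
    Antitone (transfer w f g) := fun _ _ h =>
  Finset.sum_le_sum fun b _ => mul_le_mul_of_nonneg_left (hg (hf b h)) (hw.1 b)

theorem transfer_pow_antitone [Preorder S] (hw : w ∈ stdSimplex ℝ β)
    (hf : ∀ b, Monotone fun x => f x b) {g : S → ℝ} (hg : Antitone g) (t : ℕ) :
    Antitone ((transfer w f ^ t) g) := by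
  induction t with
  | zero => exact hg
  | succ t ih =>
    rw [pow_succ', Module.End.mul_apply]
    exact transfer_antitone hw hf ih

/-- A monotone chain started from its least state is stochastically increasing in time. -/
theorem transfer_pow_bot_antitone [Preorder S] (hw : w ∈ stdSimplex ℝ β)
    (hf : ∀ b, Monotone fun x => f x b) {g : S → ℝ} (hg : Antitone g) {z : S} (hz : IsBot z) :
    Antitone fun t => (transfer w f ^ t) g z := by
  refine antitone_nat_of_succ_le fun t => ?_
  rw [transfer_pow_succ_apply]
  calc ∑ b, w b * (transfer w f ^ t) g (f z b)
      ≤ ∑ b, w b * (transfer w f ^ t) g z := Finset.sum_le_sum fun b _ =>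
        mul_le_mul_of_nonneg_left (transfer_pow_antitone hw hf hg t (hz _)) (hw.1 b)
    _ = (transfer w f ^ t) g z := by rw [← Finset.sum_mul, hw.2, one_mul]

/-- The law of a monotone chain differs from its law when started from the least state by at most
the probability of not having visited that state. -/
theorem sub_killed_le_transfer_pow [Preorder S] (hw : w ∈ stdSimplex ℝ β)
    (hf : ∀ b, Monotone fun x => f x b) {g : S → ℝ} (hg : Antitone g) (hg0 : 0 ≤ g) (hg1 : g ≤ 1)
    {z : S} (hz : IsBot z) (t : ℕ) (x : S) :
    (transfer w f ^ t) g z - (killed w f z ^ t) 1 x ≤ (transfer w f ^ t) g x := by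
  induction t generalizing x with
  | zero =>
    have h0 := hg0 x
    have h1 := hg1 z
    simp only [pow_zero, Module.End.one_apply, Pi.one_apply, Pi.zero_apply] at *
    linarith
  | succ t ih =>
    by_cases hx : x = z
    · subst hx
      rw [pow_succ' (killed w f x), Module.End.mul_apply, killed_apply_self, sub_zero]
    · rw [pow_succ' (killed w f z), Module.End.mul_apply, killed_apply_of_ne _ hx, transfer_apply,
        transfer_pow_succ_apply t g x]
      -- After one step only `t` steps remain; stochastic growth from `z` absorbs the lost time
      -- unit.
      have h1 : (transfer w f ^ (t + 1)) g z ≤ (transfer w f ^ t) g z :=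
        transfer_pow_bot_antitone hw hf hg hz t.le_succ
      have h2 : ∑ b, w b * ((transfer w f ^ t) g z - (killed w f z ^ t) 1 (f x b)) ≤
          ∑ b, w b * (transfer w f ^ t) g (f x b) := Finset.sum_le_sum fun b _ =>
        mul_le_mul_of_nonneg_left (ih (f x b)) (hw.1 b)
      simp only [mul_sub, Finset.sum_sub_distrib, ← Finset.sum_mul, hw.2, one_mul] at h2
      linarith

/-! ### Tightness, reachability and hitting. -/

/-- If every state has a successor of positive probability at which `φ` has decreased, then
`φ = 0` is reached from `φ ≤ n` with a probability bounded below. -/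
theorem exists_pow_le_transfer_pow (hw : w ∈ stdSimplex ℝ β) {φ : S → ℕ}
    (h : ∀ x, ∃ b, 0 < w b ∧ φ (f x b) ≤ φ x - 1) :
    ∃ δ : ℝ, 0 < δ ∧ ∀ n x, φ x ≤ n → δ ^ n ≤ (transfer w f ^ n) ({x | φ x = 0}.indicator 1) x := by
  obtain ⟨δ, hδ, hδw⟩ : ∃ δ : ℝ, 0 < δ ∧ ∀ b, 0 < w b → δ ≤ w b := by
    by_cases hne : (Finset.univ.filter fun b => 0 < w b).Nonempty
    · obtain ⟨b, hb, hmin⟩ := Finset.exists_min_image _ w hne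
      exact ⟨w b, (Finset.mem_filter.1 hb).2, fun c hc => hmin c (by simpa using hc)⟩
    · exact ⟨1, one_pos, fun b hb => (hne ⟨b, by simpa using hb⟩).elim⟩
  refine ⟨δ, hδ, fun n => ?_⟩
  induction n with
  | zero =>
    intro x hx
    simp [Nat.le_zero.1 hx]
  | succ n ih =>
    intro x hx
    -- Truncated subtraction matters: from `φ x = 0` the chosen successor also has `φ = 0`, so zero
    -- can be kept until time exactly `n + 1`.
    obtain ⟨b, hb, hφ⟩ := h x
    have h0 : (0 : S → ℝ) ≤ (transfer w f ^ n) ({x | φ x = 0}.indicator 1) :=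
      transfer_pow_nonneg hw n (indicator_one_nonneg _)
    calc δ ^ (n + 1) = δ * δ ^ n := pow_succ' _ _
      _ ≤ w b * (transfer w f ^ n) ({x | φ x = 0}.indicator 1) (f x b) :=
        mul_le_mul (hδw b hb) (ih _ (by omega)) (by positivity) (hw.1 b)
      _ ≤ _ := by
        rw [transfer_pow_succ_apply]
        exact Finset.single_le_sum
          (f := fun b => w b * (transfer w f ^ n) ({x | φ x = 0}.indicator 1) (f x b))
          (fun c _ => mul_nonneg (hw.1 c) (h0 _)) (Finset.mem_univ b)

/-- The values of `φ` along the chain with transition operator `T` started from `q` are tight. -/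
def IsTightAlong (T : (S → ℝ) →ₗ[ℝ] (S → ℝ)) (φ : S → ℕ) (q : S) : Prop :=
  ∀ ε : ℝ, 0 < ε → ∃ m : ℕ, ∀ t, (T ^ t) ({x | m < φ x}.indicator 1) q ≤ ε

theorem IsTightAlong.add (hw : w ∈ stdSimplex ℝ β) {φ ψ : S → ℕ} {q : S}
    (hφ : IsTightAlong (transfer w f) φ q) (hψ : IsTightAlong (transfer w f) ψ q) :
    IsTightAlong (transfer w f) (φ + ψ) q := by
  intro ε hε
  obtain ⟨m, hm⟩ := hφ (ε / 2) (half_pos hε)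
  obtain ⟨n, hn⟩ := hψ (ε / 2) (half_pos hε)
  refine ⟨m + n, fun t => ?_⟩
  have hle : ({x | m + n < (φ + ψ) x}.indicator 1 : S → ℝ) ≤
      {x | m < φ x}.indicator 1 + {x | n < ψ x}.indicator 1 := by
    intro x
    have h1 : ¬ m < φ x → ¬ n < ψ x → ¬ m + n < φ x + ψ x := by omega
    by_cases ha : m < φ x <;> by_cases hb : n < ψ x <;> by_cases hc : m + n < φ x + ψ x <;>
      simp_all
  have := monotone_pow (transfer_mono (f := f) hw) t hle q
  rw [map_add, Pi.add_apply] at this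
  linarith [hm t, hn t]

/-- At time `t - n` one has `φ ≤ n` with probability at least `1 / 2`, and from there `n` steps down
have probability at least `δ ^ n`. -/
theorem IsTightAlong.exists_lower_bound (hw : w ∈ stdSimplex ℝ β) {φ : S → ℕ} {q : S}
    (ht : IsTightAlong (transfer w f) φ q) (h : ∀ x, ∃ b, 0 < w b ∧ φ (f x b) ≤ φ x - 1) :
    ∃ δ : ℝ, 0 < δ ∧ ∃ n, ∀ t, n ≤ t → δ ≤ (transfer w f ^ t) ({x | φ x = 0}.indicator 1) q := by
  obtain ⟨δ, hδ, hr⟩ := exists_pow_le_transfer_pow hw h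
  obtain ⟨n, hn⟩ := ht (1 / 2) (by norm_num)
  refine ⟨δ ^ n * (1 / 2), by positivity, n, fun t hnt => ?_⟩
  obtain ⟨s, rfl⟩ := Nat.exists_eq_add_of_le' hnt
  have hle : δ ^ n • (1 - {x | n < φ x}.indicator 1 : S → ℝ) ≤
      (transfer w f ^ n) ({x | φ x = 0}.indicator 1) := by
    intro x
    by_cases hx : n < φ x
    · simpa [hx] using
        transfer_pow_nonneg (f := f) hw n (indicator_one_nonneg _) x
    · simpa [hx] using hr n x (not_lt.1 hx)
  have := monotone_pow (transfer_mono (f := f) hw) s hle q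
  rw [← Module.End.mul_apply, ← pow_add, map_smul, map_sub, transfer_pow_one hw] at this
  refine le_trans ?_ this
  simp only [Pi.smul_apply, Pi.sub_apply, Pi.one_apply, smul_eq_mul]
  exact mul_le_mul_of_nonneg_left (by linarith [hn s]) (by positivity)

/-- A tight chain which can reach `z` from everywhere visits `z` almost surely. -/
theorem IsTightAlong.tendsto_killed (hw : w ∈ stdSimplex ℝ β) {φ : S → ℕ} {q z : S}
    (hz : ∀ x, φ x = 0 ↔ x = z) (ht : IsTightAlong (transfer w f) φ q)
    (h : ∀ x, ∃ b, 0 < w b ∧ φ (f x b) ≤ φ x - 1) :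
    Tendsto (fun t => (killed w f z ^ t) 1 q) atTop (𝓝 0) := by
  have hset : {x | φ x = 0} = {z} := by
    ext x
    simp [hz]
  obtain ⟨δ, hδ, hr⟩ := exists_pow_le_transfer_pow hw h
  rw [hset] at hr
  set u : ℕ → ℝ := fun t => (killed w f z ^ t) 1 q with hu
  have hanti : Antitone u := fun s t hst => killed_pow_one_antitone hw z hst q
  have hnn : ∀ t, 0 ≤ u t := fun t => killed_pow_nonneg hw z t zero_le_one q
  have hlim : Tendsto u atTop (𝓝 (⨅ t, u t)) :=
    tendsto_atTop_ciInf hanti ⟨0, by rintro _ ⟨t, rfl⟩; exact hnn t⟩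
  set l := ⨅ t, u t
  have hl0 : 0 ≤ l := ge_of_tendsto' hlim hnn
  suffices l ≤ 0 by rwa [le_antisymm this hl0] at hlim
  refine le_of_forall_pos_le_add fun ε hε => ?_
  obtain ⟨n, hn⟩ := ht ε hε
  -- Of the mass surviving at time `t`, all but `ε` sits where `φ ≤ n` and loses a fraction `δ ^ n`
  -- within `n + 1` steps. In the limit `δ ^ n * (l - ε) ≤ 0`.
  have hstep : ∀ t, u (t + (n + 1)) ≤ u t - δ ^ n * (u t - ε) := by
    intro t
    have hind := indicator_one_nonneg {x | n < φ x}
    have hle : (killed w f z ^ (n + 1)) 1 ≤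
        (1 : S → ℝ) - δ ^ n • (1 - {x | n < φ x}.indicator 1 : S → ℝ) := by
      intro x
      refine (killed_pow_succ_one_le hw z n x).trans ?_
      by_cases hx : n < φ x
      · simpa [hx] using
          transfer_pow_nonneg (f := f) hw n (indicator_one_nonneg _) x
      · have := hr n x (not_lt.1 hx)
        simp only [Pi.sub_apply, Pi.smul_apply, Pi.one_apply, smul_eq_mul, Set.indicator_apply,
          Set.mem_ofPred_eq, hx, if_false, sub_zero, mul_one]
        linarith
    have h1 := monotone_pow (killed_mono (f := f) hw z) t hle q
    rw [← Module.End.mul_apply, ← pow_add, map_sub, map_smul, map_sub] at h1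
    simp only [Pi.smul_apply, Pi.sub_apply, smul_eq_mul] at h1
    have h2 := (killed_pow_le (f := f) hw z t hind q).trans (hn t)
    have h3 : δ ^ n * (u t - ε) ≤
        δ ^ n * (u t - (killed w f z ^ t) ({x | n < φ x}.indicator 1) q) :=
      mul_le_mul_of_nonneg_left (by linarith) (by positivity)
    simp only [hu] at h3 ⊢
    linarith
  have h4 := le_of_tendsto_of_tendsto' (hlim.comp (tendsto_add_atTop_nat (n + 1)))
    (hlim.sub ((hlim.sub_const ε).const_mul (δ ^ n))) hstep
  have h5 : δ ^ n * (l - ε) ≤ 0 := by linarith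
  have h6 : l - ε ≤ 0 := by
    by_contra! hc
    exact absurd h5 (not_le.2 (by positivity))
  linarith

/-! ### Foster's criterion. -/

/-- Expand with `exp u ≤ 1 + u + u ^ 2` for `|u| ≤ 1`: the linear term gains `η * ε`, and the
quadratic one costs at most half of it. -/
theorem transfer_exp_le (hw : w ∈ stdSimplex ℝ β) {W : S → ℝ} {C ε η : ℝ}
    (hη : 0 < η) (hη1 : η * C ≤ 1) (hη2 : η * C ^ 2 ≤ ε / 2)
    (hW : ∀ x b, |W (f x b) - W x| ≤ C) {x : S} (hx : transfer w f W x ≤ W x - ε) :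
    transfer w f (fun y => Real.exp (η * W y)) x ≤ (1 - η * ε / 2) * Real.exp (η * W x) := by
  have hb : ∀ b, Real.exp (η * W (f x b)) ≤
      Real.exp (η * W x) * (1 + η * (W (f x b) - W x) + η ^ 2 * C ^ 2) := by
    intro b
    have habs : |η * (W (f x b) - W x)| ≤ η * C := by
      rw [abs_mul, abs_of_pos hη]
      exact mul_le_mul_of_nonneg_left (hW x b) hη.le
    have h1 := (abs_le.1 (Real.abs_exp_sub_one_sub_id_le (habs.trans hη1))).2
    have h2 : (η * (W (f x b) - W x)) ^ 2 ≤ (η * C) ^ 2 := sq_le_sq' (abs_le.1 habs).1 (abs_le.1 habs).2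
    have h3 : η * W (f x b) = η * W x + η * (W (f x b) - W x) := by ring
    rw [h3, Real.exp_add]
    refine mul_le_mul_of_nonneg_left ?_ (Real.exp_pos _).le
    rw [← mul_pow]
    linarith
  have hsum : ∑ b, w b * (Real.exp (η * W x) * (1 + η * (W (f x b) - W x) + η ^ 2 * C ^ 2)) =
      Real.exp (η * W x) * (1 + η * (transfer w f W x - W x) + η ^ 2 * C ^ 2) := by
    have e1 : ∀ b, w b * (Real.exp (η * W x) * (1 + η * (W (f x b) - W x) + η ^ 2 * C ^ 2)) =
        w b * (Real.exp (η * W x) * (1 - η * W x + η ^ 2 * C ^ 2)) +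
          Real.exp (η * W x) * η * (w b * W (f x b)) := fun b => by ring
    simp only [e1, Finset.sum_add_distrib, ← Finset.sum_mul, ← Finset.mul_sum, hw.2,
      transfer_apply]
    ring
  rw [transfer_apply]
  refine (Finset.sum_le_sum fun b _ => mul_le_mul_of_nonneg_left (hb b) (hw.1 b)).trans ?_
  rw [hsum, mul_comm]
  refine mul_le_mul_of_nonneg_right ?_ (Real.exp_pos _).le
  nlinarith [mul_le_mul_of_nonneg_left hx hη.le, mul_le_mul_of_nonneg_left hη2 hη.le]

/-- Foster's criterion, with exponential moments. -/
theorem exists_transfer_pow_exp_le (hw : w ∈ stdSimplex ℝ β) {W : S → ℝ} {C ε : ℝ} (hε : 0 < ε)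
    (hW : ∀ x b, |W (f x b) - W x| ≤ C)
    (hdrift : ∀ x, 0 < W x → transfer w f W x ≤ W x - ε) (q : S) :
    ∃ η M : ℝ, 0 < η ∧ ∀ t, (transfer w f ^ t) (fun y => Real.exp (η * W y)) q ≤ M := by
  wlog hC : 0 < C generalizing C
  · exact this (C := max C 1) (fun x b => (hW x b).trans (le_max_left _ _))
      (lt_max_of_lt_right one_pos)
  obtain ⟨η, hη, hη1, hη2, hη3⟩ : ∃ η : ℝ, 0 < η ∧ η * C ≤ 1 ∧ η * C ^ 2 ≤ ε / 2 ∧ η * ε / 2 ≤ 1 := by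
    refine ⟨min (1 / C) (min (ε / 2 / C ^ 2) (2 / ε)), by positivity, ?_, ?_, ?_⟩
    · rw [← le_div_iff₀ hC]
      exact min_le_left _ _
    · rw [← le_div_iff₀ (by positivity)]
      exact (min_le_right _ _).trans (min_le_left _ _)
    · rw [div_le_iff₀ two_pos, one_mul, ← le_div_iff₀ hε]
      exact (min_le_right _ _).trans (min_le_right _ _)
  set V : S → ℝ := fun y => Real.exp (η * W y) with hV
  set D : ℝ := Real.exp (η * C)
  have hD : 0 < D := Real.exp_pos _
  set κ := η * ε / 2 with hκ
  have hκ0 : 0 < κ := by positivity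
  -- Contraction where `W > 0`; elsewhere one step raises `V` to at most `D`. The affine recursion
  -- has fixed point `D / κ`, hence the bound chosen below.
  have hstep : transfer w f V ≤ (1 - κ) • V + D • (1 : S → ℝ) := by
    intro x
    simp only [Pi.add_apply, Pi.smul_apply, smul_eq_mul, Pi.one_apply, mul_one]
    rcases lt_or_ge 0 (W x) with hx | hx
    · have h1 : transfer w f V x ≤ (1 - κ) * V x :=
        transfer_exp_le hw hη hη1 hη2 hW (hdrift x hx)
      linarith
    · have h1 : transfer w f V x ≤ D := by
        rw [transfer_apply]
        calc ∑ b, w b * V (f x b) ≤ ∑ b, w b * D := by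
              refine Finset.sum_le_sum fun b _ => mul_le_mul_of_nonneg_left ?_ (hw.1 b)
              refine Real.exp_le_exp.2 (mul_le_mul_of_nonneg_left ?_ hη.le)
              linarith [(abs_le.1 (hW x b)).2]
          _ = D := by rw [← Finset.sum_mul, hw.2, one_mul]
      have h2 : 0 ≤ (1 - κ) * V x := mul_nonneg (by linarith) (Real.exp_pos _).le
      linarith
  refine ⟨η, max (V q) (D / κ), hη, fun t => ?_⟩
  induction t with
  | zero => exact le_max_left _ _
  | succ t ih =>
    have h := monotone_pow (transfer_mono (f := f) hw) t hstep q
    rw [← Module.End.mul_apply, ← pow_succ, map_add, map_smul, map_smul, transfer_pow_one hw] at h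
    simp only [Pi.add_apply, Pi.smul_apply, smul_eq_mul, Pi.one_apply, mul_one] at h
    have h1 : D ≤ κ * max (V q) (D / κ) := by
      have := mul_le_mul_of_nonneg_left (le_max_right (V q) (D / κ)) hκ0.le
      rwa [mul_div_cancel₀ _ hκ0.ne'] at this
    have h2 := mul_le_mul_of_nonneg_left ih (by linarith : 0 ≤ 1 - κ)
    linarith

/-- Foster's criterion for tightness. -/
theorem isTightAlong_of_drift (hw : w ∈ stdSimplex ℝ β) {W : S → ℝ} {C ε : ℝ} (hε : 0 < ε)
    (hW : ∀ x b, |W (f x b) - W x| ≤ C)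
    (hdrift : ∀ x, 0 < W x → transfer w f W x ≤ W x - ε) (q : S) {φ : S → ℕ} {a : ℝ} (ha : 0 < a)
    (hφ : ∀ x, a * φ x ≤ W x) : IsTightAlong (transfer w f) φ q := by
  obtain ⟨η, M, hη, hM⟩ := exists_transfer_pow_exp_le hw hε hW hdrift q
  intro δ hδ
  have hlim : Tendsto (fun m : ℕ => M * Real.exp (-(η * a * m))) atTop (𝓝 (M * 0)) := by
    refine Tendsto.const_mul M (Real.tendsto_exp_neg_atTop_nhds_zero.comp ?_)
    exact tendsto_natCast_atTop_atTop.const_mul_atTop (by positivity)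
  rw [mul_zero] at hlim
  obtain ⟨m, hm⟩ := (hlim.eventually (ge_mem_nhds hδ)).exists
  refine ⟨m, fun t => ?_⟩
  -- Markov's inequality for `exp (η * W)`.
  have hle : ({x | m < φ x}.indicator 1 : S → ℝ) ≤
      Real.exp (-(η * a * m)) • fun y => Real.exp (η * W y) := by
    intro x
    simp only [Pi.smul_apply, smul_eq_mul, ← Real.exp_add]
    by_cases hx : m < φ x
    · simp only [Set.indicator_apply, Set.mem_ofPred_eq, hx, if_true, Pi.one_apply]
      have h1 : (m : ℝ) ≤ φ x := by exact_mod_cast hx.le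
      have h2 : a * m ≤ W x := (mul_le_mul_of_nonneg_left h1 ha.le).trans (hφ x)
      rw [Real.one_le_exp_iff]
      nlinarith
    · simp only [Set.indicator_apply, Set.mem_ofPred_eq, hx, if_false]
      positivity
  have h := monotone_pow (transfer_mono (f := f) hw) t hle q
  rw [map_smul] at h
  simp only [Pi.smul_apply, smul_eq_mul] at h
  refine h.trans (le_trans ?_ hm)
  rw [mul_comm]
  exact mul_le_mul_of_nonneg_right (hM t) (Real.exp_pos _).le

/-! ### Drift balance and time averages. -/

/-- In `t` steps `φ` grows by at most `t`; this allows bounding the unbounded function `φ` itself.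
-/
theorem transfer_pow_le_of_reachable (hw : w ∈ stdSimplex ℝ β) {φ : S → ℕ}
    (hφ : ∀ x b, φ (f x b) ≤ φ x + 1) {g h : S → ℝ} (t : ℕ) (q : S)
    (hgh : ∀ x, φ x ≤ φ q + t → g x ≤ h x) : (transfer w f ^ t) g q ≤ (transfer w f ^ t) h q := by
  induction t generalizing q with
  | zero => exact hgh q le_rfl
  | succ t ih =>
    rw [transfer_pow_succ_apply, transfer_pow_succ_apply]
    refine Finset.sum_le_sum fun b _ => mul_le_mul_of_nonneg_left (ih _ fun x hx => hgh x ?_) (hw.1 b)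
    have := hφ q b
    omega

/-- A tight sequence with bounded increments has zero mean drift. -/
theorem IsTightAlong.tendsto_drift (hw : w ∈ stdSimplex ℝ β) {φ : S → ℕ} {q : S}
    (ht : IsTightAlong (transfer w f) φ q) (hφ : ∀ x b, φ (f x b) ≤ φ x + 1) :
    Tendsto (fun n : ℕ => (∑ t ∈ Finset.range n, (transfer w f ^ t)
      (transfer w f (fun x => (φ x : ℝ)) - fun x => (φ x : ℝ)) q) / n) atTop (𝓝 0) := by
  set g : S → ℝ := fun x => (φ x : ℝ) with hg
  have hsum : ∀ n, ∑ t ∈ Finset.range n, (transfer w f ^ t) (transfer w f g - g) q =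
      (transfer w f ^ n) g q - g q := by
    intro n
    have := Finset.sum_range_sub (fun t => (transfer w f ^ t) g q) n
    simp only [pow_succ, Module.End.mul_apply, pow_zero, Module.End.one_apply] at this
    rw [← this]
    exact Finset.sum_congr rfl fun t _ => by rw [map_sub, Pi.sub_apply]
  simp only [hsum, sub_div]
  rw [← sub_zero (0 : ℝ)]
  refine Tendsto.sub ?_ (tendsto_const_div_atTop_nhds_zero_nat _)
  -- The drifts telescope, so it remains to see that the mean of `φ` is `o(n)`: `φ` is at most `m`
  -- except with probability `ε`, and at most `φ q + n` always.
  have hbound : ∀ ε : ℝ, 0 < ε → ∃ m : ℕ, ∀ n : ℕ, (transfer w f ^ n) g q ≤ m + (φ q + n) * ε := by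
    intro ε hε
    obtain ⟨m, hm⟩ := ht ε hε
    refine ⟨m, fun n => ?_⟩
    have h1 := transfer_pow_le_of_reachable hw hφ (g := g)
      (h := (m : ℝ) • (1 : S → ℝ) + ((φ q : ℝ) + n) • ({x | m < φ x}.indicator 1 : S → ℝ)) n q
      (fun x hx => by
        have hx' : (φ x : ℝ) ≤ φ q + n := by exact_mod_cast hx
        by_cases hxm : m < φ x
        · simp [hg, hxm]
          linarith [(m.cast_nonneg : (0 : ℝ) ≤ m)]
        · simp [hg, hxm]
          omega)
    rw [map_add, map_smul, map_smul, transfer_pow_one hw] at h1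
    simp only [Pi.add_apply, Pi.smul_apply, smul_eq_mul, Pi.one_apply, mul_one] at h1
    have h2 := mul_le_mul_of_nonneg_left (hm n) (by positivity : (0 : ℝ) ≤ φ q + n)
    linarith
  rw [Metric.tendsto_atTop]
  intro ε hε
  obtain ⟨m, hm⟩ := hbound (ε / 2) (half_pos hε)
  obtain ⟨N, hN⟩ := exists_nat_gt ((m + φ q * (ε / 2)) / (ε / 2))
  rw [div_lt_iff₀ (half_pos hε)] at hN
  refine ⟨N + 1, fun n hn => ?_⟩
  have hn' : (N : ℝ) + 1 ≤ n := by exact_mod_cast hn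
  have hn0 : (0 : ℝ) < n := by linarith [(N.cast_nonneg : (0 : ℝ) ≤ N)]
  have hnn : 0 ≤ (transfer w f ^ n) g q := transfer_pow_nonneg hw n (fun x => Nat.cast_nonneg _) q
  rw [Real.dist_eq, sub_zero, abs_of_nonneg (by positivity), div_lt_iff₀ hn0]
  have := hm n
  nlinarith

theorem le_of_tendsto_average {a : ℕ → ℝ} {δ l : ℝ} {n₀ : ℕ} (h0 : ∀ t, 0 ≤ a t)
    (hδ : ∀ t, n₀ ≤ t → δ ≤ a t)
    (h : Tendsto (fun n : ℕ => (∑ t ∈ Finset.range n, a t) / n) atTop (𝓝 l)) : δ ≤ l := by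
  have hlim : Tendsto (fun n : ℕ => δ - n₀ * δ / n) atTop (𝓝 (δ - 0)) :=
    tendsto_const_nhds.sub (tendsto_const_div_atTop_nhds_zero_nat _)
  rw [sub_zero] at hlim
  refine le_of_tendsto_of_tendsto hlim h ?_
  filter_upwards [eventually_ge_atTop (n₀ + 1)] with n hn
  have hn0 : (0 : ℝ) < n := by exact_mod_cast (by omega : 0 < n)
  rw [le_div_iff₀ hn0, sub_mul, div_mul_cancel₀ _ hn0.ne']
  have h1 : ∑ t ∈ Finset.Ico n₀ n, δ ≤ ∑ t ∈ Finset.Ico n₀ n, a t :=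
    Finset.sum_le_sum fun t ht => hδ t (Finset.mem_Ico.1 ht).1
  have h2 : ∑ t ∈ Finset.Ico n₀ n, a t ≤ ∑ t ∈ Finset.range n, a t :=
    Finset.sum_le_sum_of_subset_of_nonneg (fun t ht => by simp at ht ⊢; omega) fun t _ _ => h0 t
  rw [Finset.sum_const, Nat.card_Ico, nsmul_eq_mul, Nat.cast_sub (by omega)] at h1
  linarith

end Chain

/-! ### The law of one slot, and the queues as a Markov chain. -/

instance : DecidableEq Coin := fun a b => by
  cases a <;> cases b <;> first | exact isTrue rfl | exact isFalse (by intro h; cases h)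

instance : Fintype Coin where
  elems := {.arrP, .arrS, .chanPD, .chanPS, .chanSD, .accept, .own}
  complete c := by cases c <;> decide

theorem prod_coin (h : Coin → ℝ) :
    ∏ c, h c = h .arrP * h .arrS * h .chanPD * h .chanPS * h .chanSD * h .accept * h .own := by
  have : (Finset.univ : Finset Coin) =
      {.arrP, .arrS, .chanPD, .chanPS, .chanSD, .accept, .own} := rfl
  rw [this]
  repeat rw [Finset.prod_insert (by decide)]
  rw [Finset.prod_singleton]
  ring

/-- The law of the binary quantities of one slot. -/
noncomputable def Params.weight (θ : Params) (lamP lamS : ℝ) (b : Coin → Bool) : ℝ :=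
  ∏ c, if b c then θ.prob lamP lamS c else 1 - θ.prob lamP lamS c

variable {θ : Params} {lamP lamS : ℝ}

/-- Expectations factor over independent coins; the rates below use it with all but the relevant
factors equal to `1`. -/
theorem sum_weight_mul_prod (h : Coin → Bool → ℝ) :
    ∑ b, θ.weight lamP lamS b * ∏ c, h c (b c) =
      ∏ c, (θ.prob lamP lamS c * h c true + (1 - θ.prob lamP lamS c) * h c false) := by
  have e : ∀ c, θ.prob lamP lamS c * h c true + (1 - θ.prob lamP lamS c) * h c false =
      ∑ v : Bool, (if v then θ.prob lamP lamS c else 1 - θ.prob lamP lamS c) * h c v := by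
    intro c
    simp
  simp only [e, Finset.prod_univ_sum, Fintype.piFinset_univ, Params.weight,
    Finset.prod_mul_distrib]

theorem Params.Admissible.prob_mem (hθ : θ.Admissible) (hP : lamP ∈ Set.Icc (0 : ℝ) 1)
    (hS : lamS ∈ Set.Icc (0 : ℝ) 1) (c : Coin) : θ.prob lamP lamS c ∈ Set.Icc (0 : ℝ) 1 := by
  obtain ⟨h1, h2, h3, h4, h5, h6, h7, h8, h9⟩ := hθ
  cases c
  · exact hP
  · exact hS
  all_goals constructor <;> simp only [Params.prob] <;> linarith

theorem weight_mem_stdSimplex (h : ∀ c, θ.prob lamP lamS c ∈ Set.Icc (0 : ℝ) 1) :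
    θ.weight lamP lamS ∈ stdSimplex ℝ (Coin → Bool) := by
  refine ⟨fun b => Finset.prod_nonneg fun c _ => ?_, ?_⟩
  · split_ifs
    · exact (h c).1
    · exact sub_nonneg.2 (h c).2
  · simpa using sum_weight_mul_prod (θ := θ) (lamP := lamP) (lamS := lamS) fun _ _ => 1

theorem weight_pos {b : Coin → Bool} (h1 : ∀ c, b c = true → 0 < θ.prob lamP lamS c)
    (h0 : ∀ c, b c = false → θ.prob lamP lamS c < 1) : 0 < θ.weight lamP lamS b := by
  refine Finset.prod_pos fun c _ => ?_
  cases hc : b c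
  · simpa using h0 c hc
  · simpa using h1 c hc

theorem queues_congr {Ω Ω' : Type*} {B : Coin → ℕ → Ω → Bool}
    {B' : Coin → ℕ → Ω' → Bool} (q : State) {ω : Ω} {ω' : Ω'}
    (t : ℕ) (h : ∀ c, ∀ s < t, B c s ω = B' c s ω') : queues B q t ω = queues B' q t ω' := by
  induction t with
  | zero => rfl
  | succ t ih =>
    have h1 : (fun c => B c t ω) = fun c => B' c t ω' := funext fun c => h c t t.lt_succ_self
    simp only [queues, ih fun c s hs => h c s (hs.trans t.lt_succ_self), h1]

/-- The queues in slot `t` as a function of the finitely many binary quantities before `t`. -/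
theorem exists_queues_eq {Ω : Type*} (B : Coin → ℕ → Ω → Bool) (q : State) (t : ℕ) :
    ∃ F : (((Finset.univ : Finset Coin) ×ˢ Finset.range t : Finset (Coin × ℕ)) → Bool) → State,
      ∀ ω, queues B q t ω = F fun i => B i.1.1 i.1.2 ω := by
  classical
  refine ⟨fun β => queues (fun c s β' => if h : (c, s) ∈ (Finset.univ : Finset Coin) ×ˢ
    Finset.range t then β' ⟨_, h⟩ else false) q t β, fun ω => queues_congr q t fun c s hs => ?_⟩
  simp [hs]

section Law

variable {Ω : Type*} [MeasurableSpace Ω] {P : Measure Ω}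
  {B : Coin → ℕ → Ω → Bool}

theorem IsInput.real_slot_eq (hB : IsInput P θ lamP lamS B) [IsProbabilityMeasure P] (t : ℕ)
    (b : Coin → Bool) : P.real {ω | (fun c => B c t ω) = b} = θ.weight lamP lamS b := by
  have hind : iIndepFun (fun c : Coin => B c t) P :=
    hB.indep.precomp (g := fun c : Coin => (c, t)) fun c d h => by simpa using h
  have hset : {ω | (fun c => B c t ω) = b} = ⋂ c, B c t ⁻¹' {b c} := by
    ext ω
    simp [funext_iff]
  rw [hset, measureReal_def, hind.meas_iInter fun c => ⟨{b c}, trivial, rfl⟩, ENNReal.toReal_prod]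
  refine Finset.prod_congr rfl fun c _ => ?_
  have htrue : P.real (B c t ⁻¹' {true}) = θ.prob lamP lamS c := hB.law c t
  rw [← measureReal_def]
  cases hc : b c
  · have : B c t ⁻¹' {false} = (B c t ⁻¹' {true})ᶜ := by
      ext ω
      simp
    rw [this, probReal_compl_eq_one_sub (hB.measurable c t trivial), htrue]
    simp
  · simpa using htrue

/-- The Markov property: the state depends on coins before `t`, which are independent of those of
slot `t`. Only finitely many states can occur by time `t`, so `g` may be arbitrary. -/
theorem integral_queues_succ (hB : IsInput P θ lamP lamS B) [IsProbabilityMeasure P] (q : State)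
    (g : State → ℝ) (t : ℕ) :
    ∫ ω, g (queues B q (t + 1) ω) ∂P =
      ∫ ω, transfer (θ.weight lamP lamS) step g (queues B q t ω) ∂P := by
  classical
  obtain ⟨F, hF⟩ := exists_queues_eq B q t
  have hpast : Measurable fun ω => fun i : ((Finset.univ : Finset Coin) ×ˢ Finset.range t :
      Finset (Coin × ℕ)) => B i.1.1 i.1.2 ω := measurable_pi_lambda _ fun i => hB.measurable _ _
  have hnow : Measurable fun ω c => B c t ω := measurable_pi_lambda _ fun c => hB.measurable _ _
  have hind : IndepFun (fun ω => fun i : ((Finset.univ : Finset Coin) ×ˢ Finset.range t :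
      Finset (Coin × ℕ)) => B i.1.1 i.1.2 ω) (fun ω c => B c t ω) P := by
    have h := hB.indep.indepFun_finset (Finset.univ ×ˢ Finset.range t) (Finset.univ ×ˢ {t})
      (Finset.disjoint_left.2 fun i hi hi' => by
        rw [Finset.mem_product] at hi hi'
        exact (Finset.mem_range.1 hi.2).ne (Finset.mem_singleton.1 hi'.2))
      (fun i => hB.measurable _ _)
    exact h.comp (φ := id) (ψ := fun β c => β ⟨(c, t), by simp⟩) measurable_id
      (measurable_pi_lambda _ fun c => measurable_pi_apply _)
  set past := fun ω => fun i : ((Finset.univ : Finset Coin) ×ˢ Finset.range t :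
      Finset (Coin × ℕ)) => B i.1.1 i.1.2 ω
  set now := fun ω c => B c t ω with hnowdef
  have hint : ∀ h : _ → ℝ, Integrable (fun ω => h (past ω)) P := fun h =>
    haveI := Measure.isProbabilityMeasure_map (μ := P) hpast.aemeasurable
    (Integrable.of_finite (f := h) (μ := P.map past)).comp_measurable hpast
  have hterm : ∀ b : Coin → Bool, ∫ ω, g (step (F (past ω)) b) * (if now ω = b then 1 else 0) ∂P =
      θ.weight lamP lamS b * ∫ ω, g (step (F (past ω)) b) ∂P := by
    intro b
    have hmeas : Measurable fun v : Coin → Bool => if v = b then (1 : ℝ) else 0 :=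
      measurable_of_finite _
    have h1 := (hind.comp (φ := fun β => g (step (F β) b)) (measurable_of_finite _)
      hmeas).integral_fun_mul_eq_mul_integral
      (hint fun β => g (step (F β) b)).aestronglyMeasurable
      (hmeas.comp hnow).aestronglyMeasurable
    simp only [Function.comp_apply] at h1
    have h2 : ∫ ω, (if now ω = b then (1 : ℝ) else 0) ∂P = θ.weight lamP lamS b := by
      rw [← hB.real_slot_eq t b]
      change _ = P.real (now ⁻¹' {b})
      rw [← integral_indicator_one (hnow (measurableSet_singleton b))]
      exact integral_congr_ae (ae_of_all _ fun ω => by simp [Set.indicator_apply, hnowdef])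
    rw [h1, h2, mul_comm]
  have hterm_int : ∀ b : Coin → Bool, Integrable
      (fun ω => g (step (F (past ω)) b) * (if now ω = b then 1 else 0)) P := by
    intro b
    refine (hint fun β => g (step (F β) b)).mul_bdd (c := 1)
      (((measurable_of_finite fun v : Coin → Bool => if v = b then (1 : ℝ) else 0).comp
        hnow).aestronglyMeasurable) (ae_of_all _ fun ω => ?_)
    change ‖if now ω = b then (1 : ℝ) else 0‖ ≤ 1
    split_ifs <;> simp
  have hleft : ∀ ω, g (queues B q (t + 1) ω) =
      ∑ b : Coin → Bool, g (step (F (past ω)) b) * (if now ω = b then 1 else 0) := by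
    intro ω
    simp only [queues, hF]
    simp [past, now]
  simp only [hleft, hF, transfer_apply]
  rw [integral_finsetSum _ fun b _ => hterm_int b,
    integral_finsetSum _ fun b _ => (hint fun β => g (step (F β) b)).const_mul _]
  refine Finset.sum_congr rfl fun b _ => ?_
  rw [hterm, integral_const_mul]

theorem integral_queues (hB : IsInput P θ lamP lamS B) [IsProbabilityMeasure P] (q : State)
    (g : State → ℝ) (t : ℕ) :
    ∫ ω, g (queues B q t ω) ∂P = (transfer (θ.weight lamP lamS) step ^ t) g q := by
  induction t generalizing g with
  | zero => simp [queues]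
  | succ t ih => rw [integral_queues_succ hB, ih, pow_succ, Module.End.mul_apply]

theorem real_queues_mem (hB : IsInput P θ lamP lamS B) [IsProbabilityMeasure P] (q : State)
    (A : Set State) (t : ℕ) :
    P.real {ω | queues B q t ω ∈ A} =
      (transfer (θ.weight lamP lamS) step ^ t) (A.indicator 1) q := by
  have hA : MeasurableSet {ω | queues B q t ω ∈ A} := by
    obtain ⟨F, hF⟩ := exists_queues_eq B q t
    simp only [hF]
    exact (measurable_pi_lambda _ fun i => hB.measurable _ _) (Set.toFinite (F ⁻¹' A)).measurableSet
  rw [← integral_queues hB, ← integral_indicator_one hA]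
  rfl

end Law

/-! ### Service rates and mean drifts. -/

/-- The probability that a transmitted PU packet enters the relay queue. -/
def Params.relayRate (θ : Params) : ℝ := θ.pa * θ.fps * (1 - θ.fpd)

/-- The probability that a transmitted PU packet leaves the PU queue. -/
def Params.departRate (θ : Params) : ℝ := θ.fpd + θ.relayRate

theorem Params.Admissible.relayRate_nonneg (hθ : θ.Admissible) : 0 ≤ θ.relayRate := by
  have h1 := hθ.fpd_lt_fsd
  have h2 := hθ.fsd_le_one
  exact mul_nonneg (mul_nonneg hθ.pa_nonneg hθ.fps_nonneg) (by linarith)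

theorem Params.Admissible.departRate_pos (hθ : θ.Admissible) : 0 < θ.departRate :=
  add_pos_of_pos_of_nonneg hθ.fpd_pos hθ.relayRate_nonneg

theorem Params.Admissible.departRate_le_one (hθ : θ.Admissible) : θ.departRate ≤ 1 := by
  have h1 := hθ.fpd_lt_fsd
  have h2 := hθ.fsd_le_one
  have h3 : θ.pa * θ.fps ≤ 1 := mul_le_one₀ hθ.pa_le_one hθ.fps_nonneg hθ.fps_le_one
  have h4 : θ.relayRate ≤ 1 * (1 - θ.fpd) := mul_le_mul_of_nonneg_right h3 (by linarith)
  unfold Params.departRate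
  linarith

theorem sum_weight_mul_arrP :
    ∑ b, θ.weight lamP lamS b * ((b .arrP).toNat : ℝ) = lamP := by
  have := sum_weight_mul_prod (θ := θ) (lamP := lamP) (lamS := lamS) fun c v =>
    match c with | .arrP => (v.toNat : ℝ) | _ => 1
  simpa [prod_coin, Params.prob] using this

theorem sum_weight_mul_arrS :
    ∑ b, θ.weight lamP lamS b * ((b .arrS).toNat : ℝ) = lamS := by
  have := sum_weight_mul_prod (θ := θ) (lamP := lamP) (lamS := lamS) fun c v =>
    match c with | .arrS => (v.toNat : ℝ) | _ => 1
  simpa [prod_coin, Params.prob] using this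

theorem sum_weight_mul_own :
    ∑ b, θ.weight lamP lamS b * ((b .own && b .chanSD).toNat : ℝ) = θ.pq * θ.fsd := by
  have := sum_weight_mul_prod (θ := θ) (lamP := lamP) (lamS := lamS) fun c v =>
    match c with | .own => (v.toNat : ℝ) | .chanSD => (v.toNat : ℝ) | _ => 1
  simp only [prod_coin, Params.prob, Bool.toNat_true, Bool.toNat_false, Nat.cast_one,
    Nat.cast_zero] at this
  trans
  · refine (Finset.sum_congr rfl fun b _ => ?_).trans this
    cases b .own <;> cases b .chanSD <;> simp
  · ring

theorem sum_weight_mul_other :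
    ∑ b, θ.weight lamP lamS b * ((!b .own && b .chanSD).toNat : ℝ) = θ.fsd * (1 - θ.pq) := by
  have := sum_weight_mul_prod (θ := θ) (lamP := lamP) (lamS := lamS) fun c v =>
    match c with | .own => ((!v).toNat : ℝ) | .chanSD => (v.toNat : ℝ) | _ => 1
  simp only [prod_coin, Params.prob, Bool.toNat_true, Bool.toNat_false, Nat.cast_one,
    Nat.cast_zero, Bool.not_true, Bool.not_false] at this
  trans
  · refine (Finset.sum_congr rfl fun b _ => ?_).trans this
    cases b .own <;> cases b .chanSD <;> simp
  · ring

theorem sum_weight_mul_relay :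
    ∑ b, θ.weight lamP lamS b * ((!b .chanPD && b .chanPS && b .accept).toNat : ℝ) =
      θ.relayRate := by
  have := sum_weight_mul_prod (θ := θ) (lamP := lamP) (lamS := lamS) fun c v =>
    match c with
    | .chanPD => ((!v).toNat : ℝ) | .chanPS => (v.toNat : ℝ) | .accept => (v.toNat : ℝ) | _ => 1
  simp only [prod_coin, Params.prob, Bool.toNat_true, Bool.toNat_false, Nat.cast_one,
    Nat.cast_zero, Bool.not_true, Bool.not_false] at this
  trans
  · refine (Finset.sum_congr rfl fun b _ => ?_).trans this
    cases b .chanPD <;> cases b .chanPS <;> cases b .accept <;> simp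
  · rw [Params.relayRate]
    ring

theorem sum_weight_mul_depart :
    ∑ b, θ.weight lamP lamS b *
      ((b .chanPD || (!b .chanPD && b .chanPS && b .accept)).toNat : ℝ) = θ.departRate := by
  have := sum_weight_mul_prod (θ := θ) (lamP := lamP) (lamS := lamS) fun c v =>
    match c with | .chanPD => (v.toNat : ℝ) | _ => 1
  simp only [prod_coin, Params.prob, Bool.toNat_true, Bool.toNat_false, Nat.cast_one,
    Nat.cast_zero] at this
  rw [Params.departRate, ← sum_weight_mul_relay (θ := θ) (lamP := lamP) (lamS := lamS)]
  trans θ.fpd * 1 + ∑ b, θ.weight lamP lamS b *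
    ((!b .chanPD && b .chanPS && b .accept).toNat : ℝ)
  · rw [show θ.fpd * 1 = ∑ b, θ.weight lamP lamS b * ((b .chanPD).toNat : ℝ) by
      simpa using this.symm, ← Finset.sum_add_distrib]
    refine Finset.sum_congr rfl fun b _ => ?_
    cases b .chanPD <;> simp
  · ring

theorem cast_step_p (x : State) (b : Coin → Bool) : ((step x b).p : ℝ) =
    x.p + (b .arrP).toNat - (if x.p = 0 then 0 else 1) *
      (b .chanPD || (!b .chanPD && b .chanPS && b .accept)).toNat := by
  rcases x with ⟨_ | p, sp, s⟩
  · simp [step, direct, relayed]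
  · simp only [step, direct, relayed, Nat.succ_pos, decide_true, Bool.true_and, Nat.succ_ne_zero,
      if_false, one_mul]
    generalize (b .chanPD || (!b .chanPD && b .chanPS && b .accept)) = v
    cases v
    · simp
    · simp
      ring

theorem cast_step_sp (x : State) (b : Coin → Bool) : ((step x b).sp : ℝ) =
    x.sp + (if x.p = 0 then 0 else 1) * (!b .chanPD && b .chanPS && b .accept).toNat -
      (if x.p = 0 ∧ x.sp ≠ 0 then 1 else 0) * (!b .own && b .chanSD).toNat := by
  rcases x with ⟨_ | p, _ | sp, s⟩
  · simp [step, relayed]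
  · simp only [step, serveSP, relayed, decide_true, Bool.true_and]
    generalize (!b .own && b .chanSD) = v
    cases v <;> simp
  all_goals simp [step, serveSP, relayed]

theorem cast_step_s (x : State) (b : Coin → Bool) : ((step x b).s : ℝ) =
    x.s + (b .arrS).toNat -
      (if x.p = 0 ∧ x.s ≠ 0 then 1 else 0) * (b .own && b .chanSD).toNat := by
  rcases x with ⟨_ | p, sp, _ | s⟩
  · simp [step]
  · simp only [step, serveS, decide_true, Bool.true_and]
    generalize (b .own && b .chanSD) = v
    cases v
    · simp
    · simp
      ring
  all_goals simp [step, serveS]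

/-- Mean drift of the PU queue. -/
theorem transfer_p (hw : θ.weight lamP lamS ∈ stdSimplex ℝ (Coin → Bool)) (x : State) :
    transfer (θ.weight lamP lamS) step (fun x => (x.p : ℝ)) x =
      x.p + lamP - (if x.p = 0 then 0 else 1) * θ.departRate := by
  simp only [transfer_apply, cast_step_p, mul_add, mul_sub, Finset.sum_add_distrib,
    Finset.sum_sub_distrib, ← Finset.sum_mul, hw.2, sum_weight_mul_arrP, mul_left_comm _ (ite _ _ _),
    ← Finset.mul_sum, sum_weight_mul_depart, one_mul]

/-- Mean drift of the relay queue. -/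
theorem transfer_sp (hw : θ.weight lamP lamS ∈ stdSimplex ℝ (Coin → Bool)) (x : State) :
    transfer (θ.weight lamP lamS) step (fun x => (x.sp : ℝ)) x =
      x.sp + (if x.p = 0 then 0 else 1) * θ.relayRate -
        (if x.p = 0 ∧ x.sp ≠ 0 then 1 else 0) * (θ.fsd * (1 - θ.pq)) := by
  simp only [transfer_apply, cast_step_sp, mul_add, mul_sub, Finset.sum_add_distrib,
    Finset.sum_sub_distrib, ← Finset.sum_mul, hw.2, mul_left_comm _ (ite _ _ _),
    ← Finset.mul_sum, sum_weight_mul_relay, sum_weight_mul_other, one_mul]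

/-- Mean drift of the SU's own queue. -/
theorem transfer_s (hw : θ.weight lamP lamS ∈ stdSimplex ℝ (Coin → Bool)) (x : State) :
    transfer (θ.weight lamP lamS) step (fun x => (x.s : ℝ)) x =
      x.s + lamS - (if x.p = 0 ∧ x.s ≠ 0 then 1 else 0) * (θ.pq * θ.fsd) := by
  simp only [transfer_apply, cast_step_s, mul_add, mul_sub, Finset.sum_add_distrib,
    Finset.sum_sub_distrib, ← Finset.sum_mul, hw.2, sum_weight_mul_arrS, mul_left_comm _ (ite _ _ _),
    ← Finset.mul_sum, sum_weight_mul_own, one_mul]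

/-! ### Monotonicity, increments and emptying slots. -/

instance : PartialOrder State :=
  PartialOrder.lift (fun q => (q.p, q.sp, q.s)) fun x y h => by
    cases x
    cases y
    simp_all

theorem State.le_iff {x y : State} : x ≤ y ↔ x.p ≤ y.p ∧ x.sp ≤ y.sp ∧ x.s ≤ y.s := Iff.rfl

theorem isBot_empty : IsBot (⟨0, 0, 0⟩ : State) := fun _ =>
  State.le_iff.2 ⟨Nat.zero_le _, Nat.zero_le _, Nat.zero_le _⟩

/-- With the same inputs, longer queues stay longer. -/
theorem step_monotone (b : Coin → Bool) : Monotone fun x => step x b := by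
  rintro ⟨p, sp, s⟩ ⟨p', sp', s'⟩ h
  obtain ⟨h1, h2, h3⟩ := State.le_iff.1 h
  simp only at h1 h2 h3
  rw [State.le_iff]
  simp only [step, direct, relayed, serveS, serveSP]
  generalize b .chanPD = c1
  generalize b .chanPS = c2
  generalize b .accept = c3
  generalize b .own = c4
  generalize b .chanSD = c5
  rcases p with _ | p <;> rcases p' with _ | p' <;> simp at h1 ⊢ <;>
    cases c1 <;> cases c2 <;> cases c3 <;> cases c4 <;> cases c5 <;> simp <;> omega

theorem step_p_le (x : State) (b : Coin → Bool) : (step x b).p ≤ x.p + 1 := by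
  have := (b .arrP).toNat_le
  simp only [step]
  omega

theorem le_step_p (x : State) (b : Coin → Bool) : x.p ≤ (step x b).p + 1 := by
  have := (direct x b || relayed x b).toNat_le
  simp only [step]
  omega

theorem step_sp_le (x : State) (b : Coin → Bool) : (step x b).sp ≤ x.sp + 1 := by
  have := (relayed x b).toNat_le
  simp only [step]
  omega

theorem le_step_sp (x : State) (b : Coin → Bool) : x.sp ≤ (step x b).sp + 1 := by
  have := (serveSP x b).toNat_le
  simp only [step]
  omega

theorem step_s_le (x : State) (b : Coin → Bool) : (step x b).s ≤ x.s + 1 := by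
  have := (b .arrS).toNat_le
  simp only [step]
  omega

theorem le_step_s (x : State) (b : Coin → Bool) : x.s ≤ (step x b).s + 1 := by
  have := (serveS x b).toNat_le
  simp only [step]
  omega

/-- The outcome of a slot without arrivals in which every transmission to the destination
succeeds. -/
noncomputable def clearing (θ : Params) (own : Bool) : Coin → Bool
  | .arrP => false
  | .arrS => false
  | .chanPD => true
  -- Immaterial for the queues once `chanPD` succeeds; chosen to keep positive weight when `fps` is
  -- `0` or `1`. Likewise for `accept`.
  | .chanPS => decide (0 < θ.fps)
  | .chanSD => true
  | .accept => decide (0 < θ.pa)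
  | .own => own

theorem step_clearing (θ : Params) (own : Bool) (x : State) :
    step x (clearing θ own) = ⟨x.p - 1, x.sp - (decide (x.p = 0) && !own).toNat,
      x.s - (decide (x.p = 0) && own).toNat⟩ := by
  rcases x with ⟨_ | p, sp, s⟩ <;> simp [step, clearing, direct, relayed, serveSP, serveS]

theorem Params.Admissible.weight_clearing_pos (hθ : θ.Admissible) (hP : lamP < 1)
    (hS : lamS < 1) (own : Bool) :
    0 < θ.weight lamP lamS (clearing θ own) := by
  have hsd : 0 < θ.fsd := hθ.fpd_pos.trans hθ.fpd_lt_fsd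
  refine weight_pos (fun c hc => ?_) (fun c hc => ?_)
  · cases c <;> simp_all [clearing, Params.prob, hθ.fpd_pos, hθ.pq_pos]
  · cases c <;> simp [clearing] at hc <;> simp only [Params.prob]
    · exact hP
    · exact hS
    · linarith
    · linarith
    · exact hθ.pq_lt_one

/-! ### The region, and sufficiency of its inequalities. -/

theorem mem_region_iff (hθ : θ.Admissible) : (lamP, lamS) ∈ θ.region ↔
    lamS * θ.departRate < θ.pq * θ.fsd * (θ.departRate - lamP) ∧
      lamP * (θ.fsd * (1 - θ.pq) + θ.relayRate) < θ.fsd * (1 - θ.pq) * θ.departRate := by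
  have hA := hθ.departRate_pos
  have hsd : 0 < θ.fsd := hθ.fpd_pos.trans hθ.fpd_lt_fsd
  have hk : 0 < θ.fsd * (1 - θ.pq) + θ.relayRate :=
    add_pos_of_pos_of_nonneg (mul_pos hsd (by linarith [hθ.pq_lt_one])) hθ.relayRate_nonneg
  change lamS < θ.pq * θ.fsd * (1 - lamP / θ.departRate) ∧
    lamP < θ.fsd * (1 - θ.pq) * θ.departRate / (θ.fsd * (1 - θ.pq) + θ.relayRate) ↔ _
  rw [lt_div_iff₀ hk]
  have : θ.pq * θ.fsd * (1 - lamP / θ.departRate) =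
      θ.pq * θ.fsd * (θ.departRate - lamP) / θ.departRate := by
    field_simp
  rw [this, lt_div_iff₀ hA]

/-- Needed so that slots without arrivals have positive probability. -/
theorem lamP_lt_one_of_mem_region (hθ : θ.Admissible) (h : (lamP, lamS) ∈ θ.region) :
    lamP < 1 := by
  have hA := hθ.departRate_le_one
  have hsd : 0 < θ.fsd := hθ.fpd_pos.trans hθ.fpd_lt_fsd
  have hk : 0 < θ.fsd * (1 - θ.pq) := mul_pos hsd (by linarith [hθ.pq_lt_one])
  by_contra! h1
  have h2 := mul_le_mul_of_nonneg_left hA hk.le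
  have h3 := mul_le_mul_of_nonneg_right h1 (add_nonneg hk.le hθ.relayRate_nonneg)
  linarith [((mem_region_iff hθ).1 h).2, hθ.relayRate_nonneg]

theorem lamS_lt_one_of_mem_region (hθ : θ.Admissible) (hP : 0 ≤ lamP)
    (h : (lamP, lamS) ∈ θ.region) : lamS < 1 := by
  have hsd : 0 < θ.fsd := hθ.fpd_pos.trans hθ.fpd_lt_fsd
  have hk : θ.pq * θ.fsd ≤ 1 := mul_le_one₀ hθ.pq_lt_one.le hsd.le hθ.fsd_le_one
  have h1 := mul_nonneg (mul_pos hθ.pq_pos hsd).le hP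
  have h2 := mul_le_mul_of_nonneg_right hk hθ.departRate_pos.le
  refine lt_of_mul_lt_mul_right ?_ hθ.departRate_pos.le
  linarith [((mem_region_iff hθ).1 h).1]

/-- The slope lies slightly above `a / d`; dividing the gap by `l + 1` rather than `l` covers `l =
0`. -/
theorem exists_slope {a d l k : ℝ} (ha : 0 ≤ a) (hd : 0 < d) (hl : 0 ≤ l) (h : a * l < k * d) :
    ∃ c : ℝ, 0 < c ∧ a < c * d ∧ c * l < k := by
  have hg : 0 < k - a / d * l := by
    rw [sub_pos, div_mul_eq_mul_div, div_lt_iff₀ hd]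
    exact h
  refine ⟨a / d + (k - a / d * l) / (l + 1), by positivity, ?_, ?_⟩
  · rw [add_mul, div_mul_cancel₀ _ hd.ne']
    exact lt_add_of_pos_right _ (by positivity)
  · have h1 : (k - a / d * l) / (l + 1) * l < k - a / d * l := by
      rw [div_mul_eq_mul_div, div_lt_iff₀ (by positivity)]
      linarith
    linarith

/-- An SU queue `ψ` with drift `a₁` while the PU is busy and `a₀ - k` while the PU is idle is tight,
together with the PU queue, if its mean drift is negative. -/
theorem isTightAlong_of_rates (hw : θ.weight lamP lamS ∈ stdSimplex ℝ (Coin → Bool))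
    (hP : 0 ≤ lamP) (hA : lamP < θ.departRate) {ψ : State → ℕ}
    (hψ1 : ∀ x b, ψ (step x b) ≤ ψ x + 1) (hψ2 : ∀ x b, ψ x ≤ ψ (step x b) + 1) {a₀ a₁ k : ℝ}
    (ha : 0 ≤ a₁) (hdrift : ∀ x, transfer (θ.weight lamP lamS) step (fun x => (ψ x : ℝ)) x =
      ψ x + (if x.p = 0 then a₀ - (if ψ x = 0 then 0 else k) else a₁))
    (hk : a₁ * lamP < (k - a₀) * (θ.departRate - lamP)) (q : State) :
    IsTightAlong (transfer (θ.weight lamP lamS) step) ψ q ∧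
      IsTightAlong (transfer (θ.weight lamP lamS) step) (fun x => x.p) q := by
  -- The two bounds on `c` say that `ψ + c * p` drifts down in busy and in idle slots respectively.
  obtain ⟨c, hc, hc1, hc2⟩ := exists_slope ha (sub_pos.2 hA) hP hk
  set W : State → ℝ := (fun x => (ψ x : ℝ)) + c • fun x => (x.p : ℝ) with hW
  have hWx : ∀ x, W x = ψ x + c * x.p := fun x => rfl
  have hinc : ∀ x b, |W (step x b) - W x| ≤ 1 + c := by
    intro x b
    have h1 : ((ψ (step x b) : ℕ) : ℝ) ≤ ψ x + 1 := by exact_mod_cast hψ1 x b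
    have h2 : ((ψ x : ℕ) : ℝ) ≤ ψ (step x b) + 1 := by exact_mod_cast hψ2 x b
    have h3 : ((step x b).p : ℝ) ≤ x.p + 1 := by exact_mod_cast step_p_le x b
    have h4 : (x.p : ℝ) ≤ (step x b).p + 1 := by exact_mod_cast le_step_p x b
    have h5 := mul_le_mul_of_nonneg_left h3 hc.le
    have h6 := mul_le_mul_of_nonneg_left h4 hc.le
    rw [hWx, hWx, abs_le]
    constructor <;> linarith
  have hneg : ∀ x, 0 < W x → transfer (θ.weight lamP lamS) step W x ≤
      W x - min (c * (θ.departRate - lamP) - a₁) (k - a₀ - c * lamP) := by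
    intro x hx
    rw [hW, map_add, map_smul, Pi.add_apply, Pi.smul_apply, hdrift, transfer_p hw, ← hW, hWx,
      smul_eq_mul]
    rcases eq_or_ne x.p 0 with hp | hp
    · have hψ : ψ x ≠ 0 := by
        intro h0
        simp [hWx, hp, h0] at hx
      rw [if_pos hp, if_pos hp, if_neg hψ]
      linarith [min_le_right (c * (θ.departRate - lamP) - a₁) (k - a₀ - c * lamP)]
    · rw [if_neg hp, if_neg hp]
      linarith [min_le_left (c * (θ.departRate - lamP) - a₁) (k - a₀ - c * lamP)]
  have hε : 0 < min (c * (θ.departRate - lamP) - a₁) (k - a₀ - c * lamP) :=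
    lt_min (by linarith) (by linarith)
  refine ⟨isTightAlong_of_drift hw hε hinc hneg q one_pos fun x => ?_,
    isTightAlong_of_drift hw hε hinc hneg q hc fun x => ?_⟩
  · rw [hWx, one_mul]
    exact le_add_of_nonneg_right (by positivity)
  · rw [hWx]
    exact le_add_of_nonneg_left (Nat.cast_nonneg _)

theorem isTightAlong_of_mem_region (hθ : θ.Admissible) (hP : lamP ∈ Set.Icc (0 : ℝ) 1)
    (hS : lamS ∈ Set.Icc (0 : ℝ) 1) (h : (lamP, lamS) ∈ θ.region) (q : State) :
    IsTightAlong (transfer (θ.weight lamP lamS) step) (fun x => x.p) q ∧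
      IsTightAlong (transfer (θ.weight lamP lamS) step) (fun x => x.sp) q ∧
      IsTightAlong (transfer (θ.weight lamP lamS) step) (fun x => x.s) q := by
  have hw := weight_mem_stdSimplex (hθ.prob_mem hP hS)
  obtain ⟨h1, h2⟩ := (mem_region_iff hθ).1 h
  have hsd : 0 < θ.fsd := hθ.fpd_pos.trans hθ.fpd_lt_fsd
  have hA := hθ.departRate_pos
  have hlA : lamP < θ.departRate := by
    have h3 : 0 < θ.pq * θ.fsd * (θ.departRate - lamP) :=
      (mul_nonneg hS.1 hA.le).trans_lt h1
    have h4 := pos_of_mul_pos_right h3 (mul_pos hθ.pq_pos hsd).le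
    linarith
  obtain ⟨hsp, hp⟩ := isTightAlong_of_rates hw hP.1 hlA step_sp_le le_step_sp (a₀ := 0)
    (a₁ := θ.relayRate) (k := θ.fsd * (1 - θ.pq)) hθ.relayRate_nonneg (fun x => by
      rw [transfer_sp hw]
      by_cases hxp : x.p = 0 <;> by_cases hxs : x.sp = 0 <;> simp [hxp, hxs]
      ring) (by linarith) q
  obtain ⟨hs, -⟩ := isTightAlong_of_rates hw hP.1 hlA step_s_le le_step_s (a₀ := lamS)
    (a₁ := lamS) (k := θ.pq * θ.fsd) hS.1 (fun x => by
      rw [transfer_s hw]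
      by_cases hxp : x.p = 0 <;> by_cases hxs : x.s = 0 <;> simp [hxp, hxs]
      ring) (by linarith) q
  exact ⟨hp, hsp, hs⟩

theorem exists_step_size_le (hθ : θ.Admissible) (hP : lamP < 1) (hS : lamS < 1) (x : State) :
    ∃ b, 0 < θ.weight lamP lamS b ∧
      ((step x b).p + (step x b).sp + (step x b).s) ≤ x.p + x.sp + x.s - 1 := by
  -- The SU serves its own queue exactly when the relay queue is empty, so no idle slot is wasted.
  refine ⟨clearing θ (decide (x.sp = 0)), hθ.weight_clearing_pos hP hS _, ?_⟩
  rw [step_clearing]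
  rcases x with ⟨_ | p, _ | sp, s⟩ <;> simp
  omega

/-- If the whole system is tight and can empty, its monotone functionals converge in law. -/
theorem tendsto_transfer_pow (hw : θ.weight lamP lamS ∈ stdSimplex ℝ (Coin → Bool)) {q : State}
    (ht : IsTightAlong (transfer (θ.weight lamP lamS) step) (fun x => x.p + x.sp + x.s) q)
    (hr : ∀ x, ∃ b, 0 < θ.weight lamP lamS b ∧
      ((step x b).p + (step x b).sp + (step x b).s) ≤ x.p + x.sp + x.s - 1)
    {g : State → ℝ} (hg : Antitone g) (hg0 : 0 ≤ g) (hg1 : g ≤ 1) :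
    ∃ l, Tendsto (fun t => (transfer (θ.weight lamP lamS) step ^ t) g q) atTop (𝓝 l) := by
  have hk := ht.tendsto_killed hw (z := ⟨0, 0, 0⟩) (fun x => by
    rcases x with ⟨p, sp, s⟩
    simp [and_assoc]) hr
  have h0 : Tendsto (fun t => (transfer (θ.weight lamP lamS) step ^ t) g ⟨0, 0, 0⟩) atTop
      (𝓝 (⨅ t, (transfer (θ.weight lamP lamS) step ^ t) g ⟨0, 0, 0⟩)) :=
    tendsto_atTop_ciInf (transfer_pow_bot_antitone hw step_monotone hg isBot_empty)
      ⟨0, by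
        rintro _ ⟨t, rfl⟩
        exact transfer_pow_nonneg hw t hg0 _⟩
  have h1 := h0.sub hk
  rw [sub_zero] at h1
  exact ⟨_, tendsto_of_tendsto_of_tendsto_of_le_of_le h1 h0
    (fun t => sub_killed_le_transfer_pow hw step_monotone hg hg0 hg1 isBot_empty t q)
    fun t => transfer_pow_antitone hw step_monotone hg t (isBot_empty q)⟩

theorem queues_le {Ω : Type*} {B : Coin → ℕ → Ω → Bool} {ψ : State → ℕ}
    (hψ : ∀ x b, ψ (step x b) ≤ ψ x + 1) (q : State) (t : ℕ) (ω : Ω) :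
    ψ (queues B q t ω) ≤ ψ q + t := by
  induction t with
  | zero => rfl
  | succ t ih => exact (hψ _ _).trans (by omega)

/-! ### Tightness versus convergence in law. -/

section Stability

variable {Ω : Type*} [MeasurableSpace Ω] {P : Measure Ω} [IsProbabilityMeasure P]
  {B : Coin → ℕ → Ω → Bool}

theorem boundedQueue_iff (hB : IsInput P θ lamP lamS B) (q : State) (ψ : State → ℕ) :
    BoundedQueue P (fun t ω => ψ (queues B q t ω)) ↔
      IsTightAlong (transfer (θ.weight lamP lamS) step) ψ q := by
  simp only [BoundedQueue, IsTightAlong, ← real_queues_mem hB, Set.mem_ofPred_eq]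

theorem real_queues_lt (hB : IsInput P θ lamP lamS B)
    (hw : θ.weight lamP lamS ∈ stdSimplex ℝ (Coin → Bool)) (q : State) (ψ : State → ℕ) (m t : ℕ) :
    P.real {ω | m < ψ (queues B q t ω)} = 1 - P.real {ω | ψ (queues B q t ω) ≤ m} := by
  have h1 := real_queues_mem hB q {x | m < ψ x} t
  have h2 := real_queues_mem hB q {x | ψ x ≤ m} t
  have hsum : ({x | m < ψ x}.indicator 1 : State → ℝ) = 1 - {x | ψ x ≤ m}.indicator 1 := by
    ext x
    by_cases hx : ψ x ≤ m
    · simp [hx]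
    · simp [hx, not_le.1 hx]
  rw [hsum, map_sub, transfer_pow_one hw, Pi.sub_apply, ← h2] at h1
  exact h1

/-- Convergence controls the tails from some time `N` on; before `N` the queue is at most `ψ q + N`
deterministically. -/
theorem BoundedQueue.of_stableQueue (hB : IsInput P θ lamP lamS B)
    (hw : θ.weight lamP lamS ∈ stdSimplex ℝ (Coin → Bool)) {ψ : State → ℕ}
    (hψ : ∀ x b, ψ (step x b) ≤ ψ x + 1) {q : State}
    (h : StableQueue P fun t ω => ψ (queues B q t ω)) :
    BoundedQueue P fun t ω => ψ (queues B q t ω) := by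
  obtain ⟨F, hF, hF1⟩ := h
  intro ε hε
  obtain ⟨m, hm⟩ := (hF1.eventually (lt_mem_nhds (sub_lt_self 1 hε))).exists
  obtain ⟨N, hN⟩ := eventually_atTop.1 ((hF m).eventually (lt_mem_nhds hm))
  refine ⟨max m (ψ q + N), fun t => ?_⟩
  rcases le_total N t with ht | ht
  · have h1 : P.real {ω | max m (ψ q + N) < ψ (queues B q t ω)} ≤
        P.real {ω | m < ψ (queues B q t ω)} :=
      measureReal_mono fun ω hω =>
        (le_max_left m (ψ q + N)).trans_lt (show _ < ψ (queues B q t ω) from hω)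
    have h2 := hN t ht
    rw [real_queues_lt hB hw q ψ m] at h1
    exact h1.trans (by linarith)
  · have : {ω | max m (ψ q + N) < ψ (queues B q t ω)} = ∅ := by
      refine Set.eq_empty_of_forall_notMem fun ω hω => ?_
      have h1 := queues_le (B := B) hψ q t ω
      have h2 : max m (ψ q + N) < ψ (queues B q t ω) := hω
      omega
    rw [this, measureReal_empty]
    exact hε.le

/-- Monotonicity gives the limits `F m`; tightness of `ψ` prevents loss of mass at infinity. -/
theorem stableQueue_of_isTightAlong (hB : IsInput P θ lamP lamS B)
    (hw : θ.weight lamP lamS ∈ stdSimplex ℝ (Coin → Bool)) {q : State}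
    (ht : IsTightAlong (transfer (θ.weight lamP lamS) step) (fun x => x.p + x.sp + x.s) q)
    (hr : ∀ x, ∃ b, 0 < θ.weight lamP lamS b ∧
      ((step x b).p + (step x b).sp + (step x b).s) ≤ x.p + x.sp + x.s - 1)
    {ψ : State → ℕ} (hψ : Monotone ψ)
    (hψt : IsTightAlong (transfer (θ.weight lamP lamS) step) ψ q) :
    StableQueue P fun t ω => ψ (queues B q t ω) := by
  have hconv : ∀ m, ∃ l, Tendsto (fun t => P.real {ω | ψ (queues B q t ω) ≤ m}) atTop (𝓝 l) := by
    intro m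
    have h := tendsto_transfer_pow hw ht hr (g := {x | ψ x ≤ m}.indicator 1) (fun x y hxy => by
      have h1 : ψ y ≤ m → ψ x ≤ m := (hψ hxy).trans
      by_cases hy : ψ y ≤ m
      · simp [hy, h1 hy]
      · simpa [hy] using indicator_one_nonneg _ x)
      (indicator_one_nonneg _) (Set.indicator_le_self' fun _ _ => zero_le_one)
    simp only [← real_queues_mem hB] at h
    exact h
  choose F hF using hconv
  refine ⟨F, hF, tendsto_order.2 ⟨fun a ha => ?_, fun a ha => ?_⟩⟩
  · obtain ⟨m, hm⟩ := (boundedQueue_iff hB q ψ).2 hψt ((1 - a) / 2) (by linarith)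
    filter_upwards [eventually_ge_atTop m] with n hn
    have h1 : 1 - (1 - a) / 2 ≤ F n := ge_of_tendsto' (hF n) fun t => by
      have h2 := hm t
      rw [real_queues_lt hB hw] at h2
      have h3 : P.real {ω | ψ (queues B q t ω) ≤ m} ≤ P.real {ω | ψ (queues B q t ω) ≤ n} :=
        measureReal_mono fun ω hω => le_trans hω hn
      linarith
    linarith
  · exact Eventually.of_forall fun n =>
      (le_of_tendsto' (hF n) fun t => measureReal_le_one).trans_lt ha

end Stability

/-! ### Necessity. -/

/-- If the PU queue and the SU queue `ψ` are tight, then the long-run frequency of the slots in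
which both are empty is determined by the balance of drifts. -/
theorem exists_idle_frequency (hθ : θ.Admissible)
    (hw : θ.weight lamP lamS ∈ stdSimplex ℝ (Coin → Bool)) {q : State} {ψ : State → ℕ}
    (hp : IsTightAlong (transfer (θ.weight lamP lamS) step) (fun x => x.p) q)
    (ht : IsTightAlong (transfer (θ.weight lamP lamS) step) ψ q)
    (hψ : ∀ x b, ψ (step x b) ≤ ψ x + 1) {a₀ a₁ k : ℝ} (hk : 0 < k)
    (hdrift : ∀ x, transfer (θ.weight lamP lamS) step (fun x => (ψ x : ℝ)) x =
      ψ x + (a₀ + (if x.p = 0 then 0 else 1) * a₁) - (if x.p = 0 ∧ ψ x ≠ 0 then 1 else 0) * k) :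
    Tendsto (fun n : ℕ => (∑ t ∈ Finset.range n, (transfer (θ.weight lamP lamS) step ^ t)
      ({x | x.p + ψ x = 0}.indicator 1) q) / n) atTop
      (𝓝 (1 - lamP / θ.departRate - (a₀ + a₁ * (lamP / θ.departRate)) / k)) := by
  have hA := hθ.departRate_pos
  have h1 := hp.tendsto_drift hw step_p_le
  have h2 := ht.tendsto_drift hw hψ
  have e1 : transfer (θ.weight lamP lamS) step (fun x => (x.p : ℝ)) - (fun x => (x.p : ℝ)) =
      lamP • 1 - θ.departRate • {x | x.p ≠ 0}.indicator 1 := by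
    ext x
    rw [Pi.sub_apply, transfer_p hw]
    by_cases hx : x.p = 0 <;> simp [hx]
    ring
  have e2 : transfer (θ.weight lamP lamS) step (fun x => (ψ x : ℝ)) - (fun x => (ψ x : ℝ)) =
      a₀ • 1 + a₁ • {x | x.p ≠ 0}.indicator 1 - k • {x | x.p = 0 ∧ ψ x ≠ 0}.indicator 1 := by
    ext x
    rw [Pi.sub_apply, hdrift]
    by_cases hx : x.p = 0 <;> by_cases hy : ψ x = 0 <;> simp [hx, hy]
    ring
  have e3 : ({x | x.p + ψ x = 0}.indicator 1 : State → ℝ) =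
      1 - {x | x.p ≠ 0}.indicator 1 - {x | x.p = 0 ∧ ψ x ≠ 0}.indicator 1 := by
    ext x
    by_cases hx : x.p = 0 <;> by_cases hy : ψ x = 0 <;> simp [hx, hy]
  rw [e1] at h1
  rw [e2] at h2
  simp only [map_sub, map_smul, transfer_pow_one hw] at h1
  simp only [map_sub, map_add, map_smul, transfer_pow_one hw] at h2
  simp only [e3, map_sub, transfer_pow_one hw]
  simp only [Pi.sub_apply, Pi.add_apply, Pi.smul_apply, Pi.one_apply, smul_eq_mul, mul_one,
    Finset.sum_sub_distrib, Finset.sum_add_distrib, ← Finset.mul_sum, Finset.sum_const,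
    Finset.card_range, nsmul_eq_mul] at h1 h2 ⊢
  -- The multipliers solve for `1 - u - v`, where `u` and `v` are the frequencies of `p ≠ 0` and of
  -- `p = 0 ∧ ψ ≠ 0`.
  have h3 := (((h1.const_mul ((1 + a₁ / k) / θ.departRate)).add
    (h2.const_mul (1 / k))).add_const
      (1 - lamP / θ.departRate - (a₀ + a₁ * (lamP / θ.departRate)) / k))
  rw [mul_zero, mul_zero, zero_add, zero_add] at h3
  refine h3.congr' ?_
  filter_upwards [eventually_gt_atTop 0] with n hn
  have hn0 : (n : ℝ) ≠ 0 := by positivity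
  field_simp
  ring

/-- Bootstrapping: the weak inequalities give `lamP < 1` and `lamS < 1`, so emptying slots have
positive probability, and then the inequalities are strict. -/
theorem mem_region_of_isTightAlong (hθ : θ.Admissible) (hP : lamP ∈ Set.Icc (0 : ℝ) 1)
    (hS : lamS ∈ Set.Icc (0 : ℝ) 1) {q : State}
    (hp : IsTightAlong (transfer (θ.weight lamP lamS) step) (fun x => x.p) q)
    (hsp : IsTightAlong (transfer (θ.weight lamP lamS) step) (fun x => x.sp) q)
    (hs : IsTightAlong (transfer (θ.weight lamP lamS) step) (fun x => x.s) q) :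
    (lamP, lamS) ∈ θ.region := by
  have hw := weight_mem_stdSimplex (hθ.prob_mem hP hS)
  have hsd : 0 < θ.fsd := hθ.fpd_pos.trans hθ.fpd_lt_fsd
  have hA := hθ.departRate_pos
  have hA1 := hθ.departRate_le_one
  have hr := hθ.relayRate_nonneg
  have hpd1 : θ.fpd < 1 := hθ.fpd_lt_fsd.trans_le hθ.fsd_le_one
  have hk1 : 0 < θ.fsd * (1 - θ.pq) := mul_pos hsd (by linarith [hθ.pq_lt_one])
  have hk2 : 0 < θ.pq * θ.fsd := mul_pos hθ.pq_pos hsd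
  have hk21 : θ.pq * θ.fsd < 1 := mul_lt_one_of_nonneg_of_lt_one_left hθ.pq_pos.le hθ.pq_lt_one
    hθ.fsd_le_one
  have hind : ∀ (A : Set State) t,
      0 ≤ (transfer (θ.weight lamP lamS) step ^ t) (A.indicator 1) q := fun A t =>
    transfer_pow_nonneg hw t (indicator_one_nonneg A) q
  have l1 := exists_idle_frequency hθ hw hp hsp step_sp_le hk1 (a₀ := 0) (a₁ := θ.relayRate)
    fun x => by rw [transfer_sp hw, zero_add]
  have l2 := exists_idle_frequency hθ hw hp hs step_s_le hk2 (a₀ := lamS) (a₁ := 0)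
    fun x => by rw [transfer_s hw, mul_zero, add_zero]
  have n1 := le_of_tendsto_average (n₀ := 0) (hind _) (fun t _ => hind _ t) l1
  have n2 := le_of_tendsto_average (n₀ := 0) (hind _) (fun t _ => hind _ t) l2
  set y := lamP / θ.departRate with hy
  have hyl : lamP = y * θ.departRate := by rw [hy, div_mul_cancel₀ _ hA.ne']
  have hy0 : 0 ≤ y := div_nonneg hP.1 hA.le
  have hq1 : 0 ≤ (0 + θ.relayRate * y) / (θ.fsd * (1 - θ.pq)) := by positivity
  -- If `lamP = 1`, then `y = 1`, which forces `relayRate = 0` and so `fpd = 1`, against `fpd < fsd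
  -- ≤ 1`.
  have hP1 : lamP < 1 := by
    refine lt_of_le_of_ne hP.2 fun h1 => ?_
    have hyA : 1 ≤ y := by
      rw [hy, h1, le_div_iff₀ hA]
      linarith
    have hy1 : y = 1 := le_antisymm (by linarith) hyA
    have h2 : (0 + θ.relayRate * y) / (θ.fsd * (1 - θ.pq)) ≤ 0 := by linarith
    rw [div_le_iff₀ hk1, hy1] at h2
    rw [h1, hy1, Params.departRate] at hyl
    linarith
  have hS1 : lamS < 1 := by
    have h1 : (lamS + 0 * y) / (θ.pq * θ.fsd) ≤ 1 := by linarith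
    rw [div_le_iff₀ hk2] at h1
    linarith
  -- Only one SU queue has to empty along with `p`, so the SU can always select that queue.
  obtain ⟨δ₁, hδ₁, m₁, hm₁⟩ := (hp.add hw hsp).exists_lower_bound hw fun x => by
    refine ⟨clearing θ false, hθ.weight_clearing_pos hP1 hS1 _, ?_⟩
    rw [step_clearing]
    rcases x with ⟨_ | p, sp, s⟩ <;> simp
  obtain ⟨δ₂, hδ₂, m₂, hm₂⟩ := (hp.add hw hs).exists_lower_bound hw fun x => by
    refine ⟨clearing θ true, hθ.weight_clearing_pos hP1 hS1 _, ?_⟩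
    rw [step_clearing]
    rcases x with ⟨_ | p, sp, s⟩ <;> simp
  have d1 := hδ₁.trans_le (le_of_tendsto_average (hind _) hm₁ l1)
  have d2 := hδ₂.trans_le (le_of_tendsto_average (hind _) hm₂ l2)
  rw [mem_region_iff hθ]
  constructor
  · have h1 : (lamS + 0 * y) / (θ.pq * θ.fsd) < 1 - y := by linarith
    rw [div_lt_iff₀ hk2] at h1
    have h2 := mul_lt_mul_of_pos_right h1 hA
    rw [hyl]
    linarith
  · have h1 : (0 + θ.relayRate * y) / (θ.fsd * (1 - θ.pq)) < 1 - y := by linarith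
    rw [div_lt_iff₀ hk1] at h1
    have h2 := mul_lt_mul_of_pos_right h1 hA
    rw [hyl]
    linarith

end CognitiveRelay

open CognitiveRelay in
theorem theorem1 (θ : CognitiveRelay.Params) (hθ : θ.Admissible)
    (lamP lamS : ℝ) (hP : lamP ∈ Set.Icc (0 : ℝ) 1) (hS : lamS ∈ Set.Icc (0 : ℝ) 1)
    {Ω : Type*} [MeasurableSpace Ω] (P : MeasureTheory.Measure Ω)
    [MeasureTheory.IsProbabilityMeasure P]
    (B : CognitiveRelay.Coin → ℕ → Ω → Bool)
    (hB : CognitiveRelay.IsInput P θ lamP lamS B) (q₀ : CognitiveRelay.State) :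
    (CognitiveRelay.StableSystem P (CognitiveRelay.queues B q₀) ↔ (lamP, lamS) ∈ θ.region) ∧
      (CognitiveRelay.BoundedSystem P (CognitiveRelay.queues B q₀) ↔
        (lamP, lamS) ∈ θ.region) := by
  have hw := weight_mem_stdSimplex (hθ.prob_mem hP hS)
  have hbounded : BoundedSystem P (queues B q₀) ↔ (lamP, lamS) ∈ θ.region := by
    simp only [BoundedSystem, boundedQueue_iff hB q₀ (fun x => x.p),
      boundedQueue_iff hB q₀ (fun x => x.sp), boundedQueue_iff hB q₀ (fun x => x.s)]
    exact ⟨fun h => mem_region_of_isTightAlong hθ hP hS h.1 h.2.1 h.2.2,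
      fun h => isTightAlong_of_mem_region hθ hP hS h q₀⟩
  refine ⟨⟨fun h => hbounded.1 ⟨.of_stableQueue hB hw (ψ := fun x => x.p) step_p_le h.1,
    .of_stableQueue hB hw (ψ := fun x => x.sp) step_sp_le h.2.1,
    .of_stableQueue hB hw (ψ := fun x => x.s) step_s_le h.2.2⟩, fun h => ?_⟩, hbounded⟩
  obtain ⟨hp, hsp, hs⟩ := isTightAlong_of_mem_region hθ hP hS h q₀
  have ht := (hp.add hw hsp).add hw hs
  have hr := exists_step_size_le hθ (lamP_lt_one_of_mem_region hθ h)
    (lamS_lt_one_of_mem_region hθ hP.1 h)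
  exact ⟨stableQueue_of_isTightAlong hB hw ht hr (fun x y hxy => hxy.1) hp,
    stableQueue_of_isTightAlong hB hw ht hr (fun x y hxy => hxy.2.1) hsp,
    stableQueue_of_isTightAlong hB hw ht hr (fun x y hxy => hxy.2.2) hs⟩
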